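/- **Theorem 6 (Perpendicular Lipschitz surface).** Fix $d\ge 2$, and consider site percolation on $\mathbb Z^d$ with parameter $p$: each site is open with probability $p$, independently of the others. There is $p_0=p_0(d)<1$ such that for every $p\in(p_0,1]$ there exist random functions $L_n:\mathbb Z^{d-1}\to\mathbb Z$, $n\in\mathbb Z$ (each $L_n(x)$ being a measurable function of the percolation configuration), for which the following holds almost surely. (a) For all $n\in\mathbb Z$ and $x,x'\in\mathbb Z^{d-1}$: the site $(x,L_n(x))\in\mathbb Z^d$ is open; $|L_n(x)-L_n(x')|\le 1$ whenever $\|x-x'\|_\infty=1$; $L_n(x)>2n$; and $L_{n-1}(x)<L_n(x)$. (b) Let $\mathbb Z_{\rm odd}$ be the set of odd integers, and call a site $(x,2n+1)\in\mathbb Z^{d-1}\times\mathbb Z_{\rm odd}$ *good* if $L_n(x)=2n+1$. There exists a function $H:\mathbb Z^{d-2}\times\mathbb Z_{\rm odd}\to\mathbb Z$ such that the site $(H(u),u)$ is good for every $u\in\mathbb Z^{d-2}\times\mathbb Z_{\rm odd}$, and $|H(u)-H(u')|\le 1$ for all $u,u'\in\mathbb Z^{d-2}\times\mathbb Z_{\rm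 odd}$ with $|u_{d-1}-u'_{d-1}|\le 2$ and $|u_i-u'_i|\le 1$ for all $i\le d-2$. -/

import Mathlib

open MeasureTheory

namespace CombPercolation

/-- The sites of the lattice `ℤ ^ n`. -/
abbrev Site (n : ℕ) : Type := Fin n → ℤ

/-- Site percolation on `ℤ ^ n` with parameter `p`: the law of the random set of open sites,
each site being open with probability `p`, independently of the others. -/
noncomputable abbrev sitePercolation (n : ℕ) (p : unitInterval) : Measure (Set (Site n)) :=
  ProbabilityTheory.setBernoulli (Set.univ : Set (Site n)) p

/-- The site `(x, z)` obtained by appending the last coordinate `z` to `x`. -/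
def appendLast {n : ℕ} (x : Site n) (z : ℤ) : Site (n + 1) :=
  Fin.snoc (α := fun _ => ℤ) x z

/-- The site `(h, u)` obtained by putting the first coordinate `h` in front of `u`. -/
def consFirst {n : ℕ} (h : ℤ) (u : Site n) : Site (n + 1) :=
  Fin.cons (α := fun _ => ℤ) h u

/-- A stack of Lipschitz surfaces `L n : ℤ ^ m → ℤ`, `n ∈ ℤ`, in the set `O` of open sites of
`ℤ ^ (m + 1)`. The norm on `Site m` is the `∞`-norm. -/
structure IsLipschitzStack {m : ℕ} (O : Set (Site (m + 1))) (L : ℤ → Site m → ℤ) : Prop where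
  isOpen : ∀ n x, appendLast x (L n x) ∈ O
  lipschitz : ∀ n x x', ‖x - x'‖ = 1 → |L n x - L n x'| ≤ 1
  lower : ∀ n x, 2 * n < L n x
  strictMono : ∀ n x, L (n - 1) x < L n x

/-- The site `z = (x, 2 n + 1)`, whose last coordinate is odd, is good if `L n x = 2 n + 1`. -/
def IsGood {m : ℕ} (L : ℤ → Site m → ℤ) (z : Site (m + 1)) : Prop :=
  ∃ (x : Site m) (n : ℤ), z = appendLast x (2 * n + 1) ∧ L n x = 2 * n + 1

/-- The set `ℤ ^ k × ℤ_odd`. -/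
abbrev OddSite (k : ℕ) : Type := {u : Site (k + 1) // Odd (u (Fin.last k))}

/-- `H : ℤ ^ k × ℤ_odd → ℤ` is a Lipschitz function, with steps of `2` allowed in the last
coordinate, such that all the sites `(H u, u)` are good. -/
structure IsPerpendicularSurface {k : ℕ} (L : ℤ → Site (k + 1) → ℤ) (H : OddSite k → ℤ) :
    Prop where
  good : ∀ u : OddSite k, IsGood L (consFirst (H u) u.1)
  lipschitz : ∀ u u' : OddSite k, |u.1 (Fin.last k) - u'.1 (Fin.last k)| ≤ 2 →
    (∀ i : Fin k, |u.1 i.castSucc - u'.1 i.castSucc| ≤ 1) → |H u - H u'| ≤ 1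

end CombPercolation

/-! Both surfaces are lowest solutions: `L n x` is the highest `z` for which `(n, (x, z))` is forced
from the level sets `2 n + 1` by the steps `FreeStep` and, at closed sites, `UpStep`. Maximality
gives openness, the Lipschitz bound and monotonicity, so the issue is finiteness. Free steps lower
`height - 2 n` by one and closed sites raise it by one. After loop erasure each closed site is used
once, so a surface that is high above `x` yields a walk of length `l` from there that visits at
least `l / 2` closed sites (`Reach.exists_walk`). In particular every bad site has such a witness.

The perpendicular surface is built likewise, with bad sites as obstacles. Bad sites are dependent,
so a Vitali selection of disjoint witnesses and a second loop erasure charge its height to distinct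
closed sites (`exists_walk_of_perpPath`). Counting walks and Borel–Cantelli show that for `p` near 1
long walks almost surely meet too few closed sites (`ae_sparse`), so both suprema are finite. -/

namespace CombPercolation

open Relation

/-! ### Walks -/

section Walk

variable {d : ℕ}

/-- The sites `s` and `t` are at `∞`-distance at most `r`. -/
def Near (r : ℕ) (s t : Site d) : Prop := ∀ i, |s i - t i| ≤ r

lemma Near.symm {r : ℕ} {s t : Site d} (h : Near r s t) : Near r t s := fun i => by
  rw [abs_sub_comm]; exact h i

lemma Near.trans {r r' : ℕ} {s t v : Site d} (h : Near r s t) (h' : Near r' t v) :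
    Near (r + r') s v := fun i => by
  have := abs_sub_le (s i) (t i) (v i)
  have h1 := h i
  have h2 := h' i
  push_cast
  linarith

lemma Near.mono {r r' : ℕ} {s t : Site d} (h : Near r s t) (hr : r ≤ r') : Near r' s t :=
  fun i => (h i).trans (by exact_mod_cast hr)

/-- There is a walk of length `m` from `s` to `t`, whose steps have `∞`-norm at most one, that
visits all the sites of `A`. -/
inductive Walk : Site d → Site d → ℕ → Finset (Site d) → Prop
  | nil (s : Site d) (A : Finset (Site d)) : A ⊆ {s} → Walk s s 0 A
  | cons (s s' t : Site d) (m : ℕ) (A B : Finset (Site d)) :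
      Near 1 s s' → Walk s' t m A → B ⊆ insert s A → Walk s t (m + 1) B

lemma Walk.subset {s t : Site d} {m : ℕ} {A B : Finset (Site d)} (h : Walk s t m A)
    (hB : B ⊆ A) : Walk s t m B := by
  cases h with
  | nil s A hA => exact .nil _ _ (hB.trans hA)
  | cons s s' t m A B h1 h2 h3 => exact .cons _ _ _ _ _ _ h1 h2 (hB.trans h3)

lemma Walk.trans {s t v : Site d} {m m' : ℕ} {A A' : Finset (Site d)} (h : Walk s t m A)
    (h' : Walk t v m' A') : Walk s v (m + m') (A ∪ A') := by
  induction h with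
  | nil s A hA =>
    rw [zero_add]
    cases h' with
    | nil _ _ hA' => exact .nil _ _ (Finset.union_subset hA hA')
    | cons s s' t m A B h1 h2 h3 =>
      refine .cons _ _ _ _ _ _ h1 h2 (Finset.union_subset (hA.trans ?_) h3)
      simp
  | cons s s' t m A B h1 h2 h3 ih =>
    rw [add_right_comm]
    refine .cons _ _ _ _ _ _ h1 (ih h') ?_
    rw [← Finset.insert_union]
    exact Finset.union_subset_union_left h3

lemma Walk.single {s t : Site d} (h : Near 1 s t) : Walk s t 1 {s, t} :=
  .cons _ _ _ 0 {t} _ h (.nil _ _ subset_rfl) subset_rfl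

lemma Walk.symm {s t : Site d} {m : ℕ} {A : Finset (Site d)} (h : Walk s t m A) :
    Walk t s m A := by
  induction h with
  | nil s A hA => exact .nil _ _ hA
  | cons s s' t m A B h1 h2 h3 ih =>
    refine (ih.trans (Walk.single h1.symm)).subset (h3.trans ?_)
    intro x
    simp only [Finset.mem_insert, Finset.mem_union, Finset.mem_singleton]
    tauto

lemma Walk.of_near {r : ℕ} : ∀ {s t : Site d}, Near r s t → Walk s t r ∅ := by
  induction r with
  | zero =>
    intro s t h
    have : s = t := funext fun i => by
      have := abs_nonpos_iff.1 (h i)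
      omega
    subst this
    exact .nil _ _ (Finset.empty_subset _)
  | succ r ih =>
    intro s t h
    refine .cons s (fun i => if s i < t i then s i + 1 else if t i < s i then s i - 1 else s i)
      t r ∅ ∅ (fun i => ?_) (ih fun i => ?_) (Finset.empty_subset _)
    · dsimp only
      rw [abs_le]
      split_ifs <;> constructor <;> push_cast <;> omega
    · have := h i
      rw [abs_le] at this ⊢
      push_cast at this
      split_ifs <;> constructor <;> omega

lemma Walk.exists_near_of_mem {s t : Site d} {m : ℕ} {A : Finset (Site d)} (h : Walk s t m A)
    {x : Site d} (hx : x ∈ A) : Near m s x := by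
  induction h with
  | nil s A hA =>
    rw [Finset.mem_singleton.1 (hA hx)]
    intro i; simp
  | cons s s' t m A B h1 h2 h3 ih =>
    rcases Finset.mem_insert.1 (h3 hx) with rfl | hx
    · intro i; simp; positivity
    · exact (h1.trans (ih hx)).mono (by omega)

/-- The sets visited by the walks of length `m` from `s` are contained in few sets of size at most
`m + 1`. -/
lemma exists_walk_ranges (m : ℕ) (s : Site d) :
    ∃ R : Finset (Finset (Site d)), R.card ≤ (3 ^ d) ^ m ∧ (∀ B ∈ R, B.card ≤ m + 1) ∧
      ∀ t A, Walk s t m A → ∃ B ∈ R, A ⊆ B := by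
  induction m generalizing s with
  | zero =>
    refine ⟨{{s}}, by simp, by simp, fun t A h => ⟨{s}, by simp, ?_⟩⟩
    cases h with
    | nil _ _ hA => exact hA
  | succ m ih =>
    choose R hR1 hR2 hR3 using ih
    refine ⟨(Finset.Icc (s - 1) (s + 1)).biUnion fun s' => (R s').image (insert s), ?_, ?_, ?_⟩
    · refine (Finset.card_biUnion_le_card_mul _ _ ((3 ^ d) ^ m)
        fun s' _ => Finset.card_image_le.trans (hR1 s')).trans (le_of_eq ?_)
      have : (Finset.Icc (s - 1) (s + 1)).card = 3 ^ d := by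
        rw [Pi.card_Icc, Finset.prod_congr rfl (g := fun _ => 3)]
        · simp
        · intro i _
          simp only [Pi.add_apply, Pi.sub_apply, Pi.one_apply, Int.card_Icc]
          omega
      rw [this, pow_succ']
    · intro B hB
      obtain ⟨s', -, hB⟩ := Finset.mem_biUnion.1 hB
      obtain ⟨B', hB', rfl⟩ := Finset.mem_image.1 hB
      exact (Finset.card_insert_le _ _).trans (Nat.succ_le_succ (hR2 _ _ hB'))
    · intro t A h
      cases h with
      | cons _ s' _ _ A' _ h1 h2 h3 =>
        obtain ⟨B, hB, hAB⟩ := hR3 _ _ _ h2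
        refine ⟨insert s B, Finset.mem_biUnion.2 ⟨s', ?_, Finset.mem_image_of_mem _ hB⟩,
          h3.trans (Finset.insert_subset_insert _ hAB)⟩
        rw [Finset.mem_Icc, Pi.le_def, Pi.le_def]
        refine ⟨fun i => ?_, fun i => ?_⟩ <;>
        · have := abs_le.1 (h1 i)
          simp only [Pi.add_apply, Pi.sub_apply, Pi.one_apply]
          push_cast at this
          omega

/-- Every long walk from a given site visits few sites of `C`, compared to its length. -/
def Sparse (K : ℕ) (C : Set (Site d)) : Prop :=
  ∀ s, ∃ M, ∀ t m (A : Finset (Site d)), Walk s t m A → ↑A ⊆ C → m ≤ K * A.card → m < M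

end Walk

/-! ### Loop erasure -/

section Path

variable {σ Λ : Type*} (S : σ → σ → Prop) (U : Λ → σ → σ → Prop)

/-- A step is either a free step, or a step that uses a label from `F`. -/
def LabelledStep (F : Set Λ) (a b : σ) : Prop := S a b ∨ ∃ c ∈ F, U c a b

/-- There is a path of length `n` from `a` to `b`, made of free steps and of steps with labels
in `F`. -/
inductive LabelledPath (F : Set Λ) : ℕ → σ → σ → Prop
  | nil (a : σ) : LabelledPath F 0 a a
  | cons (a a' b : σ) (n : ℕ) : LabelledStep S U F a a' → LabelledPath F n a' b →
      LabelledPath F (n + 1) a b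

variable {S U}

lemma LabelledStep.mono {F F' : Set Λ} (hF : F ⊆ F') {a b : σ} (h : LabelledStep S U F a b) :
    LabelledStep S U F' a b :=
  h.imp_right fun ⟨c, hc, h⟩ => ⟨c, hF hc, h⟩

lemma LabelledPath.snoc {F : Set Λ} {n : ℕ} {a b b' : σ} (h : LabelledPath S U F n a b)
    (h' : LabelledStep S U F b b') : LabelledPath S U F (n + 1) a b' := by
  induction h with
  | nil a => exact .cons _ _ _ _ h' (.nil _)
  | cons a a' b n h1 h2 ih => exact .cons _ _ _ _ h1 (ih h')

/-- A path either does not use the label `c`, or it has a last step with the label `c`. -/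
lemma LabelledPath.last_use {F : Set Λ} (c : Λ) {n : ℕ} {a b : σ} (h : LabelledPath S U F n a b) :
    LabelledPath S U (F \ {c}) n a b ∨
      ∃ a₁ b₁ n', n' ≤ n ∧ U c a₁ b₁ ∧ ReflTransGen (LabelledStep S U F) a b₁ ∧
        LabelledPath S U (F \ {c}) n' b₁ b := by
  induction h with
  | nil a => exact .inl (.nil a)
  | cons a a' b n h1 h2 ih =>
    rcases ih with ih | ⟨a₁, b₁, n', hn, hU, hr, hp⟩
    · rcases h1 with h1 | ⟨c', hc', h1⟩
      · exact .inl (.cons _ _ _ _ (.inl h1) ih)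
      · by_cases hcc : c' = c
        · subst hcc
          exact .inr ⟨a, a', n, n.le_succ, h1, .single (.inr ⟨c', hc', h1⟩), ih⟩
        · exact .inl (.cons _ _ _ _ (.inr ⟨c', ⟨hc', hcc⟩, h1⟩) ih)
    · exact .inr ⟨a₁, b₁, n', hn.trans n.le_succ, hU, hr.head h1, hp⟩

/-- Erasing the loops of a path, that is, joining the first and the last step with the same label
to a single jump, leads to a path all of whose labels are distinct. -/
theorem LabelledPath.exists_loopErased [DecidableEq Λ] {F : Set Λ} {Q : σ → σ → Finset Λ → Prop}
    (nil : ∀ a, Q a a ∅) (free : ∀ a a' b G, S a a' → Q a' b G → Q a b G)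
    (jump : ∀ c a a' b' b₁ b G, c ∈ F → U c a a' → ReflTransGen (LabelledStep S U F) a b₁ →
      U c b' b₁ → c ∉ G → Q b₁ b G → Q a b (insert c G))
    {n : ℕ} {a b : σ} (h : LabelledPath S U F n a b) : ∃ G : Finset Λ, ↑G ⊆ F ∧ Q a b G := by
  -- The labels `F'` still available shrink in the induction, since the path after the last use of
  -- `c` avoids `c`. Reachability in `jump` keeps the full set `F`.
  suffices H : ∀ n, ∀ F' ⊆ F, ∀ a, LabelledPath S U F' n a b →
      ∃ G : Finset Λ, ↑G ⊆ F' ∧ Q a b G from H n F subset_rfl a h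
  clear h a n
  intro n
  induction n using Nat.strong_induction_on with
  | _ n ih =>
  intro F' hF' a h
  cases h with
  | nil a => exact ⟨∅, by simp, nil _⟩
  | cons a a' b n h1 h2 =>
    rcases h1 with h1 | ⟨c, hc, h1⟩
    · obtain ⟨G, hG, hQ⟩ := ih n n.lt_succ_self F' hF' a' h2
      exact ⟨G, hG, free _ _ _ _ h1 hQ⟩
    · have key : ∃ b' b₁ n', n' ≤ n ∧ U c b' b₁ ∧ ReflTransGen (LabelledStep S U F) a b₁ ∧
          LabelledPath S U (F' \ {c}) n' b₁ b := by
        have hstep : LabelledStep S U F a a' := .inr ⟨c, hF' hc, h1⟩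
        rcases h2.last_use c with h2 | ⟨a₁, b₁, n', hn, hU, hr, hp⟩
        · exact ⟨a, a', n, le_rfl, h1, .single hstep, h2⟩
        · exact ⟨a₁, b₁, n', hn, hU, (ReflTransGen.mono (fun _ _ => .mono hF') _ _ hr).head hstep, hp⟩
      obtain ⟨b', b₁, n', hn, hU, hr, hp⟩ := key
      obtain ⟨G, hG, hQ⟩ := ih n' (Nat.lt_succ_of_le hn) _ (Set.sdiff_subset.trans hF') _ hp
      refine ⟨insert c G, ?_, jump c _ _ _ _ _ _ (hF' hc) h1 hr hU (fun hcG => (hG hcG).2 rfl) hQ⟩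
      rw [Finset.coe_insert]
      exact Set.insert_subset hc (hG.trans Set.sdiff_subset)

end Path

/-! ### The stack of Lipschitz surfaces -/

section Stack

variable {m : ℕ}

/-- The site above `s`. -/
def above (s : Site (m + 1)) : Site (m + 1) := s + Pi.single (Fin.last m) 1

@[simp] lemma above_last (s : Site (m + 1)) : above s (Fin.last m) = s (Fin.last m) + 1 := by
  simp [above]

lemma above_appendLast (x : Site m) (z : ℤ) : above (appendLast x z) = appendLast x (z + 1) := by
  ext i
  refine Fin.lastCases ?_ (fun i => ?_) i
  · simp [appendLast]
  · simp [above, appendLast]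

@[simp] lemma appendLast_last (x : Site m) (z : ℤ) : appendLast x z (Fin.last m) = z := by
  simp [appendLast]

@[simp] lemma appendLast_castSucc (x : Site m) (z : ℤ) (i : Fin m) :
    appendLast x z i.castSucc = x i := by
  simp [appendLast]

lemma near_above (s : Site (m + 1)) : Near 1 s (above s) := fun i => by
  by_cases hi : i = Fin.last m
  · subst hi; simp
  · simp [above, hi]

lemma near_appendLast {r : ℕ} {x x' : Site m} {z z' : ℤ} (h : Near r x x') (hz : |z - z'| ≤ r) :
    Near r (appendLast x z) (appendLast x' z') := fun i => by
  refine Fin.lastCases ?_ (fun i => ?_) i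
  · simpa using hz
  · simpa using h i

/-- The pairs `(n, s)` such that `s` is below or on the surface `L n` propagate along these steps
for all the configurations of open sites. -/
def FreeStep (a b : ℤ × Site (m + 1)) : Prop :=
  (b.1 = a.1 ∧ Near 1 a.2 b.2 ∧ b.2 (Fin.last m) = a.2 (Fin.last m) - 1) ∨
    (b.1 = a.1 + 1 ∧ b.2 = above a.2)

/-- The pairs `(n, s)` such that `s` is below or on the surface `L n` propagate along this step if
the site `c` is closed. -/
def UpStep (c : Site (m + 1)) (a b : ℤ × Site (m + 1)) : Prop :=
  a.2 = c ∧ b.1 = a.1 ∧ b.2 = above c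

/-- The pair `b` is reached in `t` steps from a pair `(n, s)`, where the height of `s` is `2 n + 1`,
and where `C` is the set of closed sites. -/
def ReachIn (C : Set (Site (m + 1))) : ℕ → ℤ × Site (m + 1) → Prop
  | 0, b => b.2 (Fin.last m) = 2 * b.1 + 1
  | t + 1, b => ∃ a, ReachIn C t a ∧ LabelledStep FreeStep UpStep C a b

/-- The site `s` has to be below or on the surface `L n` if `C` is the set of closed sites. -/
def Reach (C : Set (Site (m + 1))) (n : ℤ) (s : Site (m + 1)) : Prop := ∃ t, ReachIn C t (n, s)

/-- The lowest Lipschitz surfaces in the complement of `C`. -/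
noncomputable def lipschitzStack (C : Set (Site (m + 1))) (n : ℤ) (x : Site m) : ℤ :=
  sSup {z | Reach C n (appendLast x z)}

variable {C : Set (Site (m + 1))}

lemma Reach.step {a b : ℤ × Site (m + 1)} (h : Reach C a.1 a.2)
    (hab : LabelledStep FreeStep UpStep C a b) : Reach C b.1 b.2 := by
  obtain ⟨t, ht⟩ := h
  exact ⟨t + 1, a, ht, hab⟩

lemma reach_bottom (n : ℤ) (x : Site m) : Reach C n (appendLast x (2 * n + 1)) :=
  ⟨0, by simp [ReachIn]⟩

lemma Reach.of_near {n z : ℤ} {x x' : Site m} (h : Reach C n (appendLast x z))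
    (hx : Near 1 x x') : Reach C n (appendLast x' (z - 1)) :=
  Reach.step (a := (n, appendLast x z)) (b := (n, appendLast x' (z - 1))) h
    (.inl (.inl ⟨rfl, near_appendLast hx (by simp), by simp⟩))

lemma Reach.next {n z : ℤ} {x : Site m} (h : Reach C n (appendLast x z)) :
    Reach C (n + 1) (appendLast x (z + 1)) :=
  Reach.step (a := (n, appendLast x z)) (b := (n + 1, appendLast x (z + 1))) h
    (.inl (.inr ⟨rfl, (above_appendLast _ _).symm⟩))

lemma Reach.up {n z : ℤ} {x : Site m} (h : Reach C n (appendLast x z))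
    (hC : appendLast x z ∈ C) : Reach C n (appendLast x (z + 1)) :=
  Reach.step (a := (n, appendLast x z)) (b := (n, appendLast x (z + 1))) h
    (.inr ⟨_, hC, rfl, rfl, (above_appendLast _ _).symm⟩)

lemma Reach.of_le {n z z' : ℤ} {x : Site m} (h : Reach C n (appendLast x z)) (hz : z' ≤ z) :
    Reach C n (appendLast x z') := by
  induction z', hz using Int.leInductionDown with
  | base => exact h
  | pred z' _ ih => exact ih.of_near fun i => by simp

lemma ReachIn.exists_path {t : ℕ} {b : ℤ × Site (m + 1)} (h : ReachIn C t b) :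
    ∃ a, a.2 (Fin.last m) = 2 * a.1 + 1 ∧ LabelledPath FreeStep UpStep C t a b := by
  induction t generalizing b with
  | zero => exact ⟨b, h, .nil b⟩
  | succ t ih =>
    obtain ⟨a, ha, hab⟩ := h
    obtain ⟨a', h1, h2⟩ := ih ha
    exact ⟨a', h1, h2.snoc hab⟩

/-- This makes loop erasure harmless: between two uses of the same closed site, `height - 2 n`
cannot have increased. -/
lemma fst_le_of_reflTransGen {a b : ℤ × Site (m + 1)}
    (h : ReflTransGen (LabelledStep FreeStep UpStep C) a b) : a.1 ≤ b.1 := by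
  induction h with
  | refl => exact le_rfl
  | tail _ h ih =>
    rcases h with (⟨h, -, -⟩ | ⟨h, -⟩) | ⟨c, -, -, h, -⟩ <;> omega

/-- A reached site is connected to a large set of closed sites. -/
theorem Reach.exists_walk {n z : ℤ} {x : Site m} (h : Reach C n (appendLast x z))
    (hz : 2 * n + 1 ≤ z) :
    ∃ (A : Finset (Site (m + 1))) (t : Site (m + 1)) (l : ℕ), ↑A ⊆ C ∧
      Walk (appendLast x (2 * n + 1)) t l A ∧ l ≤ 2 * A.card ∧ z - (2 * n + 1) ≤ 2 * A.card := by
  obtain ⟨t, ht⟩ := h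
  obtain ⟨a, ha, hp⟩ := ht.exists_path
  -- Length plus gain of `height - 2 n`: a free step contributes `1 - 1 = 0`, a jump at a closed
  -- site at most `1 + 1 = 2`.
  obtain ⟨A, hA, l, hl, hle⟩ := hp.exists_loopErased
    (Q := fun a b A => ∃ l : ℕ, Walk a.2 b.2 l A ∧
      (l : ℤ) + (b.2 (Fin.last m) - 2 * b.1) ≤ 2 * A.card + (a.2 (Fin.last m) - 2 * a.1))
    (fun a => ⟨0, .nil _ _ (Finset.empty_subset _), by simp⟩)
    (by
      rintro a a' b G (⟨h1, h2, h3⟩ | ⟨h1, h2⟩) ⟨l, hl, hle⟩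
      · refine ⟨l + 1, .cons _ _ _ _ _ _ h2 hl (Finset.subset_insert _ _), ?_⟩
        push_cast
        omega
      · refine ⟨l + 1, .cons _ _ _ _ _ _ (near_above a.2) (h2 ▸ hl) (Finset.subset_insert _ _), ?_⟩
        rw [h2, above_last] at hle
        push_cast
        omega)
    (by
      rintro c a a' b' b₁ b G - ⟨rfl, -, -⟩ hr ⟨-, -, h2⟩ hG ⟨l, hl, hle⟩
      refine ⟨l + 1, .cons _ _ _ _ _ _ (near_above a.2) (h2 ▸ hl) subset_rfl, ?_⟩
      have := fst_le_of_reflTransGen hr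
      rw [h2, above_last] at hle
      rw [Finset.card_insert_of_notMem hG]
      push_cast
      omega)
  simp only [appendLast_last] at hle
  -- The walk is moved to the base site `(x, 2 n + 1)` by a vertical segment, whose length is the
  -- gain already accounted for.
  have hw : Walk (appendLast x (2 * n + 1)) (appendLast x z) (z - (2 * n + 1)).toNat ∅ :=
    Walk.of_near (near_appendLast (fun i => by simp) (by rw [abs_le]; constructor <;> omega))
  refine ⟨A, _, _, hA, (hw.trans hl.symm).subset Finset.subset_union_right, ?_, ?_⟩ <;> omega

lemma Sparse.bddAbove_reach {K : ℕ} (hC : Sparse K C) (hK : 2 ≤ K) (n : ℤ) (x : Site m) :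
    BddAbove {z | Reach C n (appendLast x z)} := by
  obtain ⟨M, hM⟩ := hC (appendLast x (2 * n + 1))
  refine ⟨2 * n + 1 + M, fun z (hz : Reach C n _) => ?_⟩
  by_contra! hlt
  obtain ⟨A, t, l, hA, hw, h1, h2⟩ := hz.exists_walk (by omega)
  have h3 : 2 * A.card ≤ K * A.card := Nat.mul_le_mul_right _ hK
  -- Standing still at `t` pads the walk to length at least `M`, which `2 * A.card` still dominates.
  have := hM (t) (max l M) A ?_ hA (by omega)
  · omega
  · have h4 : Walk t t (max l M - l) (∅ : Finset (Site (m + 1))) := .of_near fun i => by simp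
    have := hw.trans h4
    rw [Finset.union_empty] at this
    convert this using 1
    omega

variable (hb : ∀ n (x : Site m), BddAbove {z | Reach C n (appendLast x z)})
include hb

lemma reach_lipschitzStack (n : ℤ) (x : Site m) :
    Reach C n (appendLast x (lipschitzStack C n x)) :=
  Int.csSup_mem ⟨_, reach_bottom n x⟩ (hb n x)

lemma le_lipschitzStack {n z : ℤ} {x : Site m} (h : Reach C n (appendLast x z)) :
    z ≤ lipschitzStack C n x :=
  le_csSup (hb n x) h

/-- Each property is closure of the reached set under one kind of step, applied at its highest site.
-/
theorem isLipschitzStack_lipschitzStack : IsLipschitzStack Cᶜ (lipschitzStack C) where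
  isOpen n x hC := by
    have := le_lipschitzStack hb ((reach_lipschitzStack hb n x).up hC)
    omega
  lipschitz n x x' h := by
    have hx : Near 1 x x' := fun i => by
      have := (pi_norm_le_iff_of_nonneg zero_le_one).1 h.le i
      rw [Int.norm_eq_abs] at this
      exact_mod_cast this
    have h1 := le_lipschitzStack hb ((reach_lipschitzStack hb n x).of_near hx)
    have h2 := le_lipschitzStack hb ((reach_lipschitzStack hb n x').of_near hx.symm)
    rw [abs_le]
    omega
  lower n x := by
    have := le_lipschitzStack hb (reach_bottom n x)
    omega
  strictMono n x := by
    have := le_lipschitzStack hb ((reach_lipschitzStack hb (n - 1) x).next)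
    rw [sub_add_cancel] at this
    omega

/-- A site that is not good is connected to a large set of closed sites. -/
theorem exists_walk_of_not_isGood {s : Site (m + 1)} (hs : Odd (s (Fin.last m)))
    (hg : ¬ IsGood (lipschitzStack C) s) :
    ∃ (A : Finset (Site (m + 1))) (t : Site (m + 1)) (l : ℕ), ↑A ⊆ C ∧ A.Nonempty ∧
      Walk s t l A ∧ l ≤ 2 * A.card := by
  obtain ⟨n, hn⟩ := hs
  have hsn : s = appendLast (Fin.init s) (2 * n + 1) := by
    rw [← hn]
    exact (Fin.snoc_init_self s).symm
  have h1 := le_lipschitzStack hb (reach_bottom n (Fin.init s))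
  have h2 : lipschitzStack C n (Fin.init s) ≠ 2 * n + 1 := fun h => hg ⟨_, n, hsn, h⟩
  obtain ⟨A, t, l, hA, hw, hl, hc⟩ := (reach_lipschitzStack hb n (Fin.init s)).exists_walk h1
  rw [← hsn] at hw
  exact ⟨A, t, l, hA, Finset.card_pos.1 (by omega), hw, hl⟩

end Stack

/-! ### The perpendicular surface -/

section Path

variable {σ Λ : Type*} {S : σ → σ → Prop} {U : Λ → σ → σ → Prop}

lemma LabelledPath.mono {Λ' : Type*} {U' : Λ' → σ → σ → Prop} {F : Set Λ} {F' : Set Λ'}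
    (hF : ∀ c ∈ F, ∀ a b, U c a b → ∃ c' ∈ F', U' c' a b) {n : ℕ} {a b : σ}
    (h : LabelledPath S U F n a b) : LabelledPath S U' F' n a b := by
  induction h with
  | nil a => exact .nil a
  | cons a a' b n h1 h2 ih =>
    exact .cons _ _ _ _ (h1.imp_right fun ⟨c, hc, h⟩ => hF c hc _ _ h) ih

lemma LabelledPath.exists_finset [DecidableEq Λ] {F : Set Λ} {n : ℕ} {a b : σ}
    (h : LabelledPath S U F n a b) :
    ∃ G : Finset Λ, ↑G ⊆ F ∧ LabelledPath S U (G : Set Λ) n a b := by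
  induction h with
  | nil a => exact ⟨∅, by simp, .nil a⟩
  | cons a a' b n h1 h2 ih =>
    obtain ⟨G, hG, hp⟩ := ih
    rcases h1 with h1 | ⟨c, hc, h1⟩
    · exact ⟨G, hG, .cons _ _ _ _ (.inl h1) hp⟩
    · refine ⟨insert c G, ?_, .cons _ _ _ _ (.inr ⟨c, by simp, h1⟩)
        (hp.mono fun c' hc' _ _ h => ⟨c', by simp_all, h⟩)⟩
      rw [Finset.coe_insert]
      exact Set.insert_subset hc hG

end Path

section Perpendicular

variable {k : ℕ}

/-- The site following `s` in the direction of the first coordinate. -/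
def ahead (s : Site (k + 1)) : Site (k + 1) := s + Pi.single 0 1

lemma near_ahead (s : Site (k + 1)) : Near 1 s (ahead s) := fun i => by
  by_cases hi : i = 0
  · subst hi; simp [ahead]
  · simp [ahead, hi]

lemma ahead_consFirst (h : ℤ) (u : Site k) : ahead (consFirst h u) = consFirst (h + 1) u := by
  ext i
  refine Fin.cases ?_ (fun i => ?_) i <;> simp [consFirst, ahead]

@[simp] lemma consFirst_zero (h : ℤ) (u : Site k) : consFirst h u 0 = h := rfl

lemma near_consFirst {r : ℕ} {u u' : Site k} {h h' : ℤ} (hu : Near r u u') (hh : |h - h'| ≤ r) :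
    Near r (consFirst h u) (consFirst h' u') := fun i => by
  refine Fin.cases ?_ (fun i => ?_) i
  · exact hh
  · exact hu i

/-- The sites behind or on the perpendicular surface propagate along these steps for all the
configurations. -/
def BackStep (a b : Site (k + 1)) : Prop := b 0 = a 0 - 1 ∧ Near 2 a b

/-- The sites behind or on the perpendicular surface propagate along this step if the site `c` is
not good. -/
def AheadStep (c a b : Site (k + 1)) : Prop := a = c ∧ b = ahead a

/-- The site `s` has to be behind or on the perpendicular surface if this surface avoids `B`. -/
def PerpReach (B : Set (Site (k + 1))) (s : Site (k + 1)) : Prop :=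
  ∃ n a, a 0 = 0 ∧ LabelledPath BackStep AheadStep B n a s

/-- The lowest surface above zero that is perpendicular to the first coordinate and avoids `B`. -/
noncomputable def perpSurface (B : Set (Site (k + 1))) (u : Site k) : ℤ :=
  sSup {h | PerpReach B (consFirst h u)}

variable {B C : Set (Site (k + 1))}

/-- If all the sites of `B` are connected to large sets of closed sites, then the same is true for
the sites reached by the perpendicular surface. -/
theorem exists_walk_of_perpPath
    (hB : ∀ s ∈ B, ∃ (A : Finset (Site (k + 1))) (t : Site (k + 1)) (l : ℕ), ↑A ⊆ C ∧
      A.Nonempty ∧ Walk s t l A ∧ l ≤ 2 * A.card)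
    {n : ℕ} {a b : Site (k + 1)} (h : LabelledPath BackStep AheadStep B n a b) :
    ∃ (A : Finset (Site (k + 1))) (l : ℕ), ↑A ⊆ C ∧ Walk a b l A ∧
      (l : ℤ) + 2 * (b 0 - a 0) ≤ 43 * A.card := by
  choose! W t l hWC hne hw hl using hB
  obtain ⟨G, hGB, hp⟩ := h.exists_finset
  -- Witness cardinalities play the role of radii; passing to finitely many labels bounds them.
  obtain ⟨u, huG, hdisj, hcov⟩ := Vitali.exists_disjoint_subfamily_covering_enlargement
    (fun s => (W s : Set (Site (k + 1)))) (G : Set (Site (k + 1))) (fun s => ((W s).card : ℝ)) 2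
    one_lt_two (fun _ _ => by positivity) (∑ s ∈ G, ((W s).card : ℝ))
    (fun s hs => Finset.single_le_sum (f := fun s => ((W s).card : ℝ))
      (fun _ _ => by positivity) hs)
    (fun s hs => hne s (hGB hs))
  have huB : u ⊆ B := huG.trans hGB
  -- Here `W s` meets `W c` and `(W s).card ≤ 2 * (W c).card`, so `s` and `c` are within `2 * 2 + 2
  -- = 6` times `(W c).card`.
  have hp' : LabelledPath BackStep
      (fun c a b : Site (k + 1) => Near (6 * (W c).card) a c ∧ b = ahead a) u n a b := by
    refine hp.mono ?_
    rintro _ hs s _ ⟨rfl, rfl⟩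
    obtain ⟨c, hc, ⟨x, hx1, hx2⟩, hle⟩ := hcov _ hs
    refine ⟨c, hc, ?_, rfl⟩
    have hle' : (W s).card ≤ 2 * (W c).card := by exact_mod_cast hle
    refine (((hw s (hGB hs)).exists_near_of_mem hx1).trans
      ((hw c (huB hc)).exists_near_of_mem hx2).symm).mono ?_
    have h1 := hl s (hGB hs)
    have h2 := hl c (huB hc)
    omega
  -- A back step has length 2 and loses 1, hence the factor 2. With `w = (W c).card ≥ 1`, a jump has
  -- length at most `16 w + 1`, including the detour through `W c` and back, and gains at most `12 w
  -- + 1`: in total `40 w + 3 ≤ 43 w`.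
  obtain ⟨G', hG', m, hm, hle⟩ := hp'.exists_loopErased
    (Q := fun a b G' => ∃ m : ℕ, Walk a b m (G'.biUnion W) ∧
      (m : ℤ) + 2 * (b 0 - a 0) ≤ 43 * ∑ c ∈ G', (W c).card)
    (fun a => ⟨0, .nil _ _ (by simp), by simp⟩)
    (by
      rintro a a' b G' ⟨h1, h2⟩ ⟨m, hm, hle⟩
      refine ⟨2 + m, ((Walk.of_near h2).trans hm).subset Finset.subset_union_right, ?_⟩
      push_cast at hle ⊢
      omega)
    (by
      rintro c a a' b' b₁ b G' hc ⟨h1, -⟩ - ⟨h2, rfl⟩ hG' ⟨m, hm, hle⟩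
      have hnear := h2.symm.trans (near_ahead b')
      have hWc := hw c (huB hc)
      refine ⟨6 * (W c).card + (l c + (l c + (6 * (W c).card + 1 + m))),
        ((Walk.of_near h1).trans (hWc.trans (hWc.symm.trans
          ((Walk.of_near hnear).trans hm)))).subset ?_, ?_⟩
      · rw [Finset.biUnion_insert]
        intro x
        simp only [Finset.mem_union]
        tauto
      · rw [Finset.sum_insert hG']
        have hpos := (hne c (huB hc)).card_pos
        have hlc := hl c (huB hc)
        have h3 := abs_le.1 ((h1.trans hnear) 0)
        push_cast at hle h3 ⊢
        omega)
  refine ⟨G'.biUnion W, m, ?_, hm, ?_⟩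
  · intro x hx
    obtain ⟨c, hc, hx⟩ := Finset.mem_biUnion.1 (Finset.mem_coe.1 hx)
    exact hWC c (huB (hG' hc)) hx
  · rwa [Finset.card_biUnion fun x hx y hy hxy =>
      Finset.disjoint_coe.1 (hdisj (hG' hx) (hG' hy) hxy)]

lemma Sparse.bddAbove_perpReach {K : ℕ} (hC : Sparse K C) (hK : 43 ≤ K)
    (hB : ∀ s ∈ B, ∃ (A : Finset (Site (k + 1))) (t : Site (k + 1)) (l : ℕ), ↑A ⊆ C ∧
      A.Nonempty ∧ Walk s t l A ∧ l ≤ 2 * A.card) (u : Site k) :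
    BddAbove {h | PerpReach B (consFirst h u)} := by
  obtain ⟨M, hM⟩ := hC (consFirst 0 u)
  refine ⟨M, fun h ⟨n, a, ha, hp⟩ => ?_⟩
  by_contra! hlt
  obtain ⟨A, l, hA, hw, hle⟩ := exists_walk_of_perpPath hB hp
  rw [consFirst_zero, ha] at hle
  have hw' : Walk (consFirst 0 u) (consFirst h u) h.toNat ∅ :=
    Walk.of_near (near_consFirst (fun i => by simp) (by rw [abs_le]; omega))
  have h1 : 43 * A.card ≤ K * A.card := Nat.mul_le_mul_right _ hK
  have := hM _ _ A ((hw'.trans hw.symm).subset Finset.subset_union_right) hA (by omega)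
  omega

lemma perpReach_zero (u : Site k) : PerpReach B (consFirst 0 u) := ⟨0, _, rfl, .nil _⟩

variable (hb : ∀ u : Site k, BddAbove {h | PerpReach B (consFirst h u)})
include hb

lemma perpReach_perpSurface (u : Site k) : PerpReach B (consFirst (perpSurface B u) u) :=
  Int.csSup_mem ⟨_, perpReach_zero u⟩ (hb u)

lemma le_perpSurface {h : ℤ} {u : Site k} (hu : PerpReach B (consFirst h u)) :
    h ≤ perpSurface B u :=
  le_csSup (hb u) hu

lemma consFirst_perpSurface_notMem (u : Site k) : consFirst (perpSurface B u) u ∉ B := fun hB => by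
  obtain ⟨n, a, ha, hp⟩ := perpReach_perpSurface hb u
  have : PerpReach B (consFirst (perpSurface B u + 1) u) :=
    ⟨n + 1, a, ha, hp.snoc (.inr ⟨_, hB, rfl, (ahead_consFirst _ _).symm⟩)⟩
  have := le_perpSurface hb this
  omega

lemma perpSurface_sub_le {u u' : Site k} (hu : Near 2 u u') :
    perpSurface B u - 1 ≤ perpSurface B u' := by
  obtain ⟨n, a, ha, hp⟩ := perpReach_perpSurface hb u
  exact le_perpSurface hb ⟨n + 1, a, ha,
    hp.snoc (.inl ⟨rfl, near_consFirst hu (by simp)⟩)⟩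

end Perpendicular

/-- If the closed sites are sparse, then some perpendicular surface consists of good sites. -/
theorem Sparse.exists_isPerpendicularSurface {k K : ℕ} {C : Set (Site (k + 2))} (hC : Sparse K C)
    (hK : 43 ≤ K) :
    ∃ H : OddSite k → ℤ, IsPerpendicularSurface (lipschitzStack C) H := by
  -- Sites with even last coordinate are no obstacles, so the surface can be built over all of `ℤ ^
  -- (k + 1)` and then restricted.
  set B : Set (Site (k + 2)) := {s | Odd (s (Fin.last _)) ∧ ¬ IsGood (lipschitzStack C) s}
  have hb := hC.bddAbove_perpReach hK (B := B) fun s hs =>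
    exists_walk_of_not_isGood (hC.bddAbove_reach (by omega)) hs.1 hs.2
  refine ⟨fun u => perpSurface B u.1, fun u => ?_, fun u u' h1 h2 => ?_⟩
  · by_contra hg
    exact consFirst_perpSurface_notMem hb u.1 ⟨u.2, hg⟩
  · have hu : Near 2 u.1 u'.1 := fun i => by
      refine Fin.lastCases ?_ (fun i => ?_) i
      · exact_mod_cast h1
      · exact (h2 i).trans (by norm_num)
    have h3 := perpSurface_sub_le hb hu
    have h4 := perpSurface_sub_le hb hu.symm
    rw [abs_le]
    omega

/-! ### Sparsity of the closed sites -/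

section Probability

open unitInterval
open scoped ENNReal NNReal

variable {d : ℕ}

lemma sitePercolation_subset_compl (p : I) (A : Finset (Site d)) :
    sitePercolation d p {ω | ↑A ⊆ ωᶜ} = (toNNReal (σ p) : ℝ≥0∞) ^ A.card := by
  rw [sitePercolation, ProbabilityTheory.setBernoulli_apply']
  have : (fun q : Site d → Prop ↦ {i | q i}) ⁻¹' {ω | ↑A ⊆ ωᶜ} =
      Set.pi A fun _ => ({False} : Set Prop) := by
    ext q
    simp [Set.subset_def, Set.mem_pi]
  rw [this, Measure.infinitePi_pi _ (by simp)]
  simp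

/-- Union bound over the ranges of walks and their subsets `A`; the condition `m ≤ K * A.card` turns
`(r ^ K) ^ A.card` into at most `r ^ m`. -/
lemma sitePercolation_exists_walk_le {K : ℕ} (p : I) (r : ℝ≥0) (hr : r ≤ 1)
    (hp : toNNReal (σ p) ≤ r ^ K) (m : ℕ) (s : Site d) :
    sitePercolation d p {ω | ∃ t A, Walk s t m A ∧ ↑A ⊆ ωᶜ ∧ m ≤ K * A.card} ≤
      ((3 ^ d) ^ m * (2 ^ (m + 1) * r ^ m) : ℝ≥0) := by
  obtain ⟨R, hR1, hR2, hR3⟩ := exists_walk_ranges m s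
  have hsub : {ω : Set (Site d) | ∃ t A, Walk s t m A ∧ ↑A ⊆ ωᶜ ∧ m ≤ K * A.card} ⊆
      ⋃ B ∈ R, ⋃ A ∈ B.powerset.filter (fun A => m ≤ K * A.card), {ω | ↑A ⊆ ωᶜ} := by
    rintro ω ⟨t, A, hw, hA, hm⟩
    obtain ⟨B, hB, hAB⟩ := hR3 t A hw
    simp only [Set.mem_iUnion]
    exact ⟨B, hB, A, by simp [hAB, hm], hA⟩
  refine (measure_mono hsub).trans ((measure_biUnion_finset_le _ _).trans ?_)
  have hB : ∀ B ∈ R, sitePercolation d p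
      (⋃ A ∈ B.powerset.filter (fun A => m ≤ K * A.card), {ω | ↑A ⊆ ωᶜ}) ≤
      ((2 ^ (m + 1) * r ^ m : ℝ≥0) : ℝ≥0∞) := by
    intro B hB
    refine (measure_biUnion_finset_le _ _).trans ((Finset.sum_le_card_nsmul _ _ ((r ^ m : ℝ≥0) :
      ℝ≥0∞) fun A hA => ?_).trans ?_)
    · rw [sitePercolation_subset_compl, ← ENNReal.coe_pow, ENNReal.coe_le_coe]
      calc toNNReal (σ p) ^ A.card ≤ (r ^ K) ^ A.card := pow_le_pow_left' hp _
        _ = r ^ (K * A.card) := (pow_mul _ _ _).symm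
        _ ≤ r ^ m := pow_le_pow_of_le_one zero_le hr (Finset.mem_filter.1 hA).2
    · rw [nsmul_eq_mul, ENNReal.coe_mul]
      gcongr
      have : (B.powerset.filter (fun A => m ≤ K * A.card)).card ≤ 2 ^ (m + 1) :=
        (Finset.card_filter_le _ _).trans (by
          rw [Finset.card_powerset]
          exact Nat.pow_le_pow_right two_pos (hR2 B hB))
      exact_mod_cast this
  refine (Finset.sum_le_card_nsmul _ _ _ hB).trans ?_
  rw [nsmul_eq_mul, ENNReal.coe_mul ((3 ^ d) ^ m)]
  gcongr
  exact_mod_cast hR1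

/-- Borel–Cantelli: `r = (4 * 3 ^ d)⁻¹` makes the union bound equal to `2 * (1 / 2) ^ m`. -/
theorem ae_sparse (K : ℕ) (p : I) (hp : toNNReal (σ p) ≤ ((4 * 3 ^ d)⁻¹ : ℝ≥0) ^ K) :
    ∀ᵐ ω ∂(sitePercolation d p), Sparse K (ωᶜ : Set (Site d)) := by
  refine ae_all_iff.2 fun s => ?_
  have hr : ((4 * 3 ^ d)⁻¹ : ℝ≥0) ≤ 1 :=
    inv_le_one_of_one_le₀ (one_le_mul (by norm_num) (one_le_pow₀ (by norm_num)))
  have hsum : ∑' m : ℕ, sitePercolation d p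
      {ω | ∃ t A, Walk s t m A ∧ ↑A ⊆ ωᶜ ∧ m ≤ K * A.card} ≠ ∞ := by
    have hle : ∀ m : ℕ, sitePercolation d p
        {ω | ∃ t A, Walk s t m A ∧ ↑A ⊆ ωᶜ ∧ m ≤ K * A.card} ≤
          ((2 * (1 / 2 : ℝ≥0) ^ m : ℝ≥0) : ℝ≥0∞) := fun m => by
      refine (sitePercolation_exists_walk_le p _ hr hp m s).trans (le_of_eq ?_)
      congr 1
      rw [pow_succ', mul_assoc, mul_left_comm, ← mul_pow, ← mul_pow]
      congr 2
      field_simp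
      norm_num
    refine ne_top_of_le_ne_top ?_ (ENNReal.tsum_le_tsum hle)
    refine ENNReal.tsum_coe_ne_top_iff_summable.2 (Summable.mul_left _ ?_)
    exact NNReal.summable_geometric (by norm_num [← NNReal.coe_lt_coe])
  filter_upwards [ae_eventually_notMem hsum] with ω hω
  obtain ⟨M, hM⟩ := Filter.eventually_atTop.1 hω
  refine ⟨M, fun t m A hw hA hm => ?_⟩
  by_contra! hlt
  exact hM m hlt ⟨t, A, hw, hA, hm⟩

end Probability

/-! ### Measurability -/

section Measurability

variable {m : ℕ}

lemma measurable_reachIn (t : ℕ) (b : ℤ × Site (m + 1)) :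
    Measurable fun ω : Set (Site (m + 1)) => ReachIn ωᶜ t b := by
  induction t generalizing b with
  | zero => exact measurable_const
  | succ t ih =>
    refine Measurable.exists fun a => (ih a).and (measurable_const.or (Measurable.exists fun c => ?_))
    exact (measurable_set_notMem c).and measurable_const

lemma measurable_reach (n : ℤ) (s : Site (m + 1)) :
    Measurable fun ω : Set (Site (m + 1)) => Reach ωᶜ n s :=
  Measurable.exists fun t => measurable_reachIn t (n, s)

/-- The reached heights are closed downwards, so two memberships detect the supremum; the last
alternative is the default value `0` of `sSup` on unbounded sets. -/
lemma lipschitzStack_eq_iff {C : Set (Site (m + 1))} {n z : ℤ} {x : Site m} :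
    lipschitzStack C n x = z ↔
      (Reach C n (appendLast x z) ∧ ¬ Reach C n (appendLast x (z + 1))) ∨
        (z = 0 ∧ ∀ z', Reach C n (appendLast x z')) := by
  by_cases hb : BddAbove {z | Reach C n (appendLast x z)}
  · have hmem : Reach C n (appendLast x (lipschitzStack C n x)) :=
      Int.csSup_mem ⟨_, reach_bottom n x⟩ hb
    have hle : ∀ z, Reach C n (appendLast x z) → z ≤ lipschitzStack C n x :=
      fun z hz => le_csSup hb hz
    have hall : ¬ ∀ z', Reach C n (appendLast x z') := fun h => by
      have := hle _ (h (lipschitzStack C n x + 1))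
      omega
    constructor
    · rintro rfl
      refine .inl ⟨hmem, fun h => ?_⟩
      have := hle _ h
      omega
    · rintro (⟨h1, h2⟩ | ⟨-, h⟩)
      · refine le_antisymm (not_lt.1 fun h => h2 (hmem.of_le h)) (hle _ h1)
      · exact absurd h hall
  · have hall : ∀ z', Reach C n (appendLast x z') := fun z' => by
      obtain ⟨z, hz, hlt⟩ := not_bddAbove_iff.1 hb z'
      exact Reach.of_le hz hlt.le
    rw [lipschitzStack, Int.csSup_of_not_bddAbove hb]
    constructor
    · rintro rfl
      exact .inr ⟨rfl, hall⟩
    · rintro (⟨-, h⟩ | ⟨rfl, -⟩)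
      · exact absurd (hall _) h
      · rfl

theorem measurable_lipschitzStack (n : ℤ) (x : Site m) :
    Measurable fun ω : Set (Site (m + 1)) => lipschitzStack ωᶜ n x := by
  refine measurable_to_countable' fun z => ?_
  have : (fun ω : Set (Site (m + 1)) => lipschitzStack ωᶜ n x) ⁻¹' {z} =
      {ω | (Reach ωᶜ n (appendLast x z) ∧ ¬ Reach ωᶜ n (appendLast x (z + 1))) ∨
        (z = 0 ∧ ∀ z', Reach ωᶜ n (appendLast x z'))} :=
    Set.ext fun ω => lipschitzStack_eq_iff
  rw [this]
  exact measurableSet_setOfPred.2 (((measurable_reach _ _).and (measurable_reach _ _).not).or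
    (measurable_const.and (Measurable.forall fun z' => measurable_reach _ _)))

end Measurability

end CombPercolation

/-- The dimension is `d = k + 2`. The surfaces `L n` are random functions, that is, measurable
functions `L ω n x` of the percolation configuration `ω`. -/
theorem theorem6 (k : ℕ) :
    ∃ p₀ : ℝ, p₀ < 1 ∧ ∀ p : unitInterval, p₀ < (p : ℝ) →
      ∃ L : Set (CombPercolation.Site (k + 2)) → ℤ → CombPercolation.Site (k + 1) → ℤ,
        (∀ n x, Measurable fun ω => L ω n x) ∧
        ∀ᵐ ω ∂(CombPercolation.sitePercolation (k + 2) p),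
          CombPercolation.IsLipschitzStack ω (L ω) ∧
          ∃ H : CombPercolation.OddSite k → ℤ,
            CombPercolation.IsPerpendicularSurface (L ω) H := by
  -- The exponent 43 is the constant of the perpendicular surface; it also covers the constant 2 of
  -- the stack.
  have hpos : (0 : ℝ) < ((4 * 3 ^ (k + 2))⁻¹) ^ 43 := by positivity
  refine ⟨1 - ((4 * 3 ^ (k + 2))⁻¹) ^ 43, by linarith, fun p hp =>
    ⟨fun ω => CombPercolation.lipschitzStack ωᶜ,
      CombPercolation.measurable_lipschitzStack, ?_⟩⟩
  have hq : unitInterval.toNNReal (unitInterval.symm p) ≤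
      ((4 * 3 ^ (k + 2))⁻¹ : NNReal) ^ 43 := by
    rw [← NNReal.coe_le_coe]
    push_cast
    rw [unitInterval.coe_toNNReal, unitInterval.coe_symm_eq]
    linarith
  filter_upwards [CombPercolation.ae_sparse 43 p hq] with ω hω
  refine ⟨?_, hω.exists_isPerpendicularSurface le_rfl⟩
  simpa using CombPercolation.isLipschitzStack_lipschitzStack
    (hω.bddAbove_reach (by norm_num))
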